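/- Let $\Lambda$ be a lattice isometric to $H^{\oplus p}\oplus (\varepsilon E_8)^{\oplus k}$ with $p\ge 3$, $k\ge 0$, $\varepsilon=\pm1$, where $H$ is the even hyperbolic plane and $E_8$ the positive definite $E_8$-lattice. (For a K3 surface $S$, the lattice $\Lambda=H^2(S,\mathbb Z)$ with its intersection form is of this type, with $p=3$, $k=2$, $\varepsilon=-1$; for an abelian surface $p=3$, $k=0$.) Let $\mathbb Z\oplus\Lambda\oplus\mathbb Z$ (that is, $H^*(S,\mathbb Z)=H^0\oplus H^2\oplus H^4$ when $\Lambda=H^2(S,\mathbb Z)$ for a K3 surface $S$) be the Mukai lattice, with the pairing $$\big((r',c',s'),(r'',c'',s'')\big)=c'\cdot c''-r's''-r''s'.$$ Let $\Gamma$ be its isometry group, let $m\ge 1$ be an integer, put $v=(1,0,-m)$, and let $\Gamma_v\subset\Gamma$ be the stabilizer of $v$. Let $\Gamma_0=O(\Lambda)$ be the isometry group of $\Lambda$, embedded in $\Gamma$ by letting it act as the identity on the two summands $\mathbb Z$. For $u$ with $(u,u)=-2$ let $\tau_u(x)=x+(u,x)u$ be the reflection in $u$. Then $\Gamma_v$ is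 the subgroup of $\Gamma$ generated by $\Gamma_0$ together with the reflections $\tau_u$ in the $-2$ vectors $u=(1,-L,m)$, where $L\in\Lambda$ runs over all primitive classes (that is, classes not of the form $nL'$ with $L'\in\Lambda$ and an integer $n\neq\pm1$) with $L\cdot L=2m-2$. -/

import Mathlib

/-- The even unimodular lattice `H^p ⊕ (ε E₈)^k`, where `H` is the even hyperbolic plane `ℤ²` with
`(x, x') · (y, y') = x y' + x' y`, and `ε = ±1`. For a K3 surface, `H²(S, ℤ)` with its intersection
form is `(-E₈)² ⊕ H³`, i.e. `ε = -1`, `p = 3`, `k = 2`. For an abelian surface it is `H³`. -/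
noncomputable def evenUnimodularForm (ε : ℤˣ) (p k : ℕ) :
    LinearMap.BilinForm ℤ ((Fin p → ℤ × ℤ) × (Fin k → Fin 8 → ℤ)) :=
  LinearMap.mk₂ ℤ
    (fun x y =>
      (∑ i, ((x.1 i).1 * (y.1 i).2 + (x.1 i).2 * (y.1 i).1)) +
        (ε : ℤ) * ∑ j, Matrix.toBilin' CartanMatrix.E₈ (x.2 j) (y.2 j))
    (by
      intro x x' y
      simp only [Prod.fst_add, Prod.snd_add, Pi.add_apply, map_add, LinearMap.add_apply,
        add_mul, Finset.sum_add_distrib]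
      ring)
    (by
      intro c x y
      simp only [Prod.smul_fst, Prod.smul_snd, Pi.smul_apply, map_smul, LinearMap.smul_apply,
        smul_eq_mul, mul_add, Finset.sum_add_distrib, Finset.mul_sum]
      simp only [mul_assoc, mul_left_comm])
    (by
      intro x y y'
      simp only [Prod.fst_add, Prod.snd_add, Pi.add_apply, map_add, mul_add,
        Finset.sum_add_distrib]
      ring)
    (by
      intro c x y
      simp only [Prod.smul_fst, Prod.smul_snd, Pi.smul_apply, map_smul,
        smul_eq_mul, mul_add, Finset.sum_add_distrib, Finset.mul_sum]
      simp only [mul_left_comm])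

/-- The isometry group `O(M)` of a lattice `M` with bilinear form `B`. -/
def isometryGroup {M : Type*} [AddCommGroup M] (B : LinearMap.BilinForm ℤ M) :
    Subgroup (M ≃ₗ[ℤ] M) where
  carrier := {g | ∀ x y, B (g x) (g y) = B x y}
  mul_mem' := by
    intro g h hg hh x y
    simp only [LinearEquiv.mul_apply]
    rw [hg, hh]
  one_mem' := fun _ _ => rfl
  inv_mem' := by
    intro g hg x y
    have h := hg (g⁻¹ x) (g⁻¹ y)
    rw [← LinearEquiv.mul_apply, ← LinearEquiv.mul_apply, mul_inv_cancel] at h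
    exact h.symm

/-- The reflection `τ_u(x) = x + (u, x) u` in a vector `u` with `(u, u) = -2`. -/
def minusTwoReflection {M : Type*} [AddCommGroup M] (B : LinearMap.BilinForm ℤ M) (u : M)
    (hu : B u u = -2) : M ≃ₗ[ℤ] M :=
  Module.reflection (x := u) (f := -(B u)) (by simp [hu])

/-- A class is primitive if it is not a multiple of a class by an integer other than `±1`.
In particular `0 = 2 • 0` is not primitive. -/
def IsPrimitiveClass {Λ : Type*} [AddCommGroup Λ] (L : Λ) : Prop :=
  ∀ (n : ℤ) (y : Λ), L = n • y → IsUnit n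

/-- The Mukai pairing on `ℤ ⊕ Λ ⊕ ℤ` (that is `H⁰ ⊕ H² ⊕ H⁴`, when `Λ = H²(S, ℤ)`):
`((r', c', s'), (r'', c'', s'')) = c' · c'' - r' s'' - r'' s'`. -/
def mukaiForm {Λ : Type*} [AddCommGroup Λ] (b : LinearMap.BilinForm ℤ Λ) :
    LinearMap.BilinForm ℤ (ℤ × Λ × ℤ) :=
  LinearMap.mk₂ ℤ
    (fun x y => b x.2.1 y.2.1 - x.1 * y.2.2 - y.1 * x.2.2)
    (by intro x x' y; simp; ring)
    (by intro c x y; simp; ring)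
    (by intro x y y'; simp; ring)
    (by intro c x y; simp; ring)

/-- Extension of an automorphism of `Λ = H²` to the Mukai lattice by the identity on
`H⁰ ⊕ H⁴`. -/
def extendByIdentity (Λ : Type*) [AddCommGroup Λ] :
    (Λ ≃ₗ[ℤ] Λ) →* ((ℤ × Λ × ℤ) ≃ₗ[ℤ] (ℤ × Λ × ℤ)) where
  toFun g := (LinearEquiv.refl ℤ ℤ).prodCongr (g.prodCongr (LinearEquiv.refl ℤ ℤ))
  map_one' := rfl
  map_mul' _ _ := rfl

@[simp]
theorem extendByIdentity_apply {Λ : Type*} [AddCommGroup Λ] (g : Λ ≃ₗ[ℤ] Λ) (x : ℤ × Λ × ℤ) :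
    extendByIdentity Λ g x = (x.1, g x.2.1, x.2.2) := rfl

/-- `Γ_v`: the stabilizer of `v` in the isometry group `Γ` of the Mukai lattice. -/
def mukaiStabilizer {Λ : Type*} [AddCommGroup Λ] (b : LinearMap.BilinForm ℤ Λ)
    (v : ℤ × Λ × ℤ) : Subgroup ((ℤ × Λ × ℤ) ≃ₗ[ℤ] (ℤ × Λ × ℤ)) :=
  isometryGroup (mukaiForm b) ⊓ MulAction.stabilizer ((ℤ × Λ × ℤ) ≃ₗ[ℤ] (ℤ × Λ × ℤ)) v

/-- `Γ₀ = O(Λ)`, embedded in the isometry group of the Mukai lattice. -/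
def gammaZero {Λ : Type*} [AddCommGroup Λ] (b : LinearMap.BilinForm ℤ Λ) :
    Subgroup ((ℤ × Λ × ℤ) ≃ₗ[ℤ] (ℤ × Λ × ℤ)) :=
  (isometryGroup b).map (extendByIdentity Λ)

/-- The reflections in the `-2` vectors `(1, -L, m)` of the Mukai lattice, with `L` a primitive
class of self-intersection `2m - 2`. -/
def lineBundleReflections {Λ : Type*} [AddCommGroup Λ] (b : LinearMap.BilinForm ℤ Λ) (m : ℤ) :
    Set ((ℤ × Λ × ℤ) ≃ₗ[ℤ] (ℤ × Λ × ℤ)) :=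
  {g | ∃ (L : Λ) (hu : mukaiForm b (1, -L, m) (1, -L, m) = -2),
    IsPrimitiveClass L ∧ b L L = 2 * m - 2 ∧ g = minusTwoReflection (mukaiForm b) (1, -L, m) hu}

/-!
Write `e = (0, 0, 1)` and `v = (1, 0, -m)`. An isometry that fixes `v` and `e` fixes both summands
`ℤ` and hence comes from `O(Λ)` (`mem_gammaZero`). So it is enough to show that the subgroup `G`
generated by `O(Λ)` and the reflections acts transitively on the orbit of `e` under `Γ_v`. Every
vector of that orbit is isotropic and pairs to `-1` with `v`, that is, it has the form
`(a, c, 1 + m a)` with `c · c = 2 a (1 + m a)`. The reflection in `(1, -L, m)` sends this vector to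
the one with `a' = a + t` and `c' = c - t L`, where `t = -(L · c + 1 + 2 m a)`, so the task is to
reach `a = 0, c = 0` by such moves.

* Write `c = n c₀` with `c₀` primitive. The lattice contains a hyperbolic plane orthogonal to `c`,
  hence a class `L` with `L · c = 0`. As `(1 + 2 m a)² ≡ 1` modulo `n`, the class `c'` is primitive
  (`exists_move_to_primitive`).
* If `c` is primitive, then `L` may be chosen with any prescribed value of `L · c`, and so
  as to make `a' = -1`. The new class `c'` is again primitive (`exists_move_to_neg_one`).
* If `a = -1` and `c` is primitive, then `c · c = 2 m - 2`, and `L = c` leads to `e`.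

That a class is primitive is used, and proved, in the form that it pairs to `1` with some class;
this is where unimodularity enters. A hyperbolic plane orthogonal to a given class is already found
inside two of the summands `H`, by the euclidean algorithm
(`exists_hyperbolic_pair_orthogonal`).
-/

/-! ### The even unimodular lattice -/

/-- The properties of the lattice on which the proof rests: the form is symmetric, even and
unimodular, and every class is orthogonal to a hyperbolic plane. Unimodularity is expressed as
divisibility: a class `c` with `n ∣ c · y` for all `y` is divisible by `n`. -/
structure IsEvenUnimodularWithPlanes {Λ : Type*} [AddCommGroup Λ] (b : LinearMap.BilinForm ℤ Λ) :
    Prop where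
  symm : ∀ x y, b x y = b y x
  even : ∀ x, Even (b x x)
  divisible : ∀ (n : ℤ) (c : Λ), (∀ y, n ∣ b c y) → ∃ c₀, c = n • c₀
  exists_plane : ∀ c, ∃ e f, b e e = 0 ∧ b f f = 0 ∧ b e f = 1 ∧ b c e = 0 ∧ b c f = 0

theorem IsEvenUnimodularWithPlanes.of_equivalent {Λ Λ' : Type*} [AddCommGroup Λ] [AddCommGroup Λ']
    {b : LinearMap.BilinForm ℤ Λ} {b' : LinearMap.BilinForm ℤ Λ'} (h : b.Equivalent b')
    (hb' : IsEvenUnimodularWithPlanes b') : IsEvenUnimodularWithPlanes b := by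
  obtain ⟨φ⟩ := h
  have key : ∀ x y, b x y = b' (φ x) (φ y) := fun x y => (φ.map_app _ _).symm
  have surj : ∀ y, ∃ x, φ x = y := φ.toLinearEquiv.surjective
  refine ⟨fun x y => ?_, fun x => ?_, fun n c hc => ?_, fun c => ?_⟩
  · rw [key, key, hb'.symm]
  · rw [key]
    exact hb'.even _
  · obtain ⟨d, hd⟩ := hb'.divisible n (φ c) fun y => by
      obtain ⟨x, rfl⟩ := surj y
      rw [← key]
      exact hc x
    obtain ⟨c₀, rfl⟩ := surj d
    refine ⟨c₀, φ.toLinearEquiv.injective ?_⟩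
    rw [map_smul]
    exact hd
  · obtain ⟨e, f, h⟩ := hb'.exists_plane (φ c)
    obtain ⟨e, rfl⟩ := surj e
    obtain ⟨f, rfl⟩ := surj f
    refine ⟨e, f, ?_⟩
    simpa only [key] using h

/-- The pairing `(a, b, c, d) · (a', b', c', d') = a b' + b a' + c d' + d c'` of `H ⊕ H`. -/
def twoPlanes (x y : ℤ × ℤ × ℤ × ℤ) : ℤ :=
  x.1 * y.2.1 + x.2.1 * y.1 + x.2.2.1 * y.2.2.2 + x.2.2.2 * y.2.2.1

/-- The existence of a hyperbolic pair of `H ⊕ H` orthogonal to `x`. -/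
def HasOrthogonalPair (x : ℤ × ℤ × ℤ × ℤ) : Prop :=
  ∃ e f, twoPlanes e e = 0 ∧ twoPlanes f f = 0 ∧ twoPlanes e f = 1 ∧
    twoPlanes x e = 0 ∧ twoPlanes x f = 0

theorem HasOrthogonalPair.of_isometry {x x' : ℤ × ℤ × ℤ × ℤ}
    (σ : ℤ × ℤ × ℤ × ℤ → ℤ × ℤ × ℤ × ℤ) (hσ : ∀ y z, twoPlanes (σ y) (σ z) = twoPlanes y z)
    (hx : σ x' = x) (h : HasOrthogonalPair x') : HasOrthogonalPair x := by
  obtain ⟨e, f, h₁, h₂, h₃, h₄, h₅⟩ := h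
  refine ⟨σ e, σ f, ?_, ?_, ?_, ?_, ?_⟩ <;> simpa only [← hx, hσ]

/-- Swapping the planes and subtracting multiples of `a` from the other coordinates by Eichler
transvections, one runs the euclidean algorithm on `a` until `c = d = 0`, when the second plane is
orthogonal to the vector. -/
theorem hasOrthogonalPair_of_ne_zero (n : ℕ) : ∀ a b c d : ℤ, a ≠ 0 → a.natAbs ≤ n →
    HasOrthogonalPair (a, b, c, d) := by
  induction n with
  | zero => intro a b c d ha h; omega
  | succ n ih =>
    intro a b c d ha hn
    have lt : ∀ c : ℤ, (c % a).natAbs < a.natAbs := fun c => by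
      have h₁ := Int.emod_nonneg c ha
      have h₂ := Int.emod_lt_abs c ha
      rw [← Int.ofNat_lt, Int.natCast_natAbs, Int.natCast_natAbs, abs_of_nonneg h₁]
      exact h₂
    -- It suffices to treat the vector whose third coordinate is reduced modulo `a`.
    apply HasOrthogonalPair.of_isometry (x' := (a, b + c / a * d, c % a, d))
      (fun y => (y.1, y.2.1 - c / a * y.2.2.2, y.2.2.1 + c / a * y.1, y.2.2.2))
      (fun y z => by simp only [twoPlanes]; ring)
      (by simp [Int.emod_add_ediv_mul])
    by_cases hc : c % a = 0
    · -- Now the same for the fourth coordinate.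
      apply HasOrthogonalPair.of_isometry (x' := (a, b + c / a * d, c % a, d % a))
        (fun y => (y.1, y.2.1 - d / a * y.2.2.1, y.2.2.1, y.2.2.2 + d / a * y.1))
        (fun y z => by simp only [twoPlanes]; ring)
        (by simp [Int.emod_add_ediv_mul, hc])
      by_cases hd : d % a = 0
      · exact ⟨(0, 0, 1, 0), (0, 0, 0, 1), by simp [twoPlanes, hc, hd]⟩
      · apply HasOrthogonalPair.of_isometry (x' := (d % a, c % a, b + c / a * d, a))
          (fun y => (y.2.2.2, y.2.2.1, y.2.1, y.1))
          (fun y z => by simp only [twoPlanes]; ring) rfl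
        exact ih _ _ _ _ hd (by have := lt d; omega)
    · apply HasOrthogonalPair.of_isometry (x' := (c % a, d, a, b + c / a * d))
        (fun y => (y.2.2.1, y.2.2.2, y.1, y.2.1))
        (fun y z => by simp only [twoPlanes]; ring) rfl
      exact ih _ _ _ _ hc (by have := lt c; omega)

theorem exists_hyperbolic_pair_orthogonal (x : ℤ × ℤ × ℤ × ℤ) : HasOrthogonalPair x := by
  obtain ⟨a, b, c, d⟩ := x
  by_cases ha : a = 0
  · by_cases hb : b = 0
    · subst ha hb
      exact ⟨(1, 0, 0, 0), (0, 1, 0, 0), by simp [twoPlanes]⟩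
    · exact HasOrthogonalPair.of_isometry (x' := (b, a, c, d))
        (fun y => (y.2.1, y.1, y.2.2.1, y.2.2.2)) (fun y z => by simp only [twoPlanes]; ring) rfl
        (hasOrthogonalPair_of_ne_zero _ _ _ _ _ hb le_rfl)
  · exact hasOrthogonalPair_of_ne_zero _ _ _ _ _ ha le_rfl

/-- A symmetric integral form that is even on a basis is even. -/
theorem even_apply_self_of_basis {ι M : Type*} [AddCommGroup M] (B : LinearMap.BilinForm ℤ M)
    (hB : ∀ x y, B x y = B y x) (e : Module.Basis ι ℤ M) (he : ∀ i, Even (B (e i) (e i))) (x : M) :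
    Even (B x x) := by
  have hx : x ∈ Submodule.span ℤ (Set.range e) := e.mem_span x
  induction hx using Submodule.span_induction with
  | mem x h => obtain ⟨i, rfl⟩ := h; exact he i
  | zero => simp
  | add x y _ _ hx hy =>
    have : B (x + y) (x + y) = B x x + B y y + (B x y + B x y) := by
      simp only [map_add, LinearMap.add_apply, hB y x]
      ring
    rw [this]
    exact (hx.add hy).add ⟨_, rfl⟩
  | smul n x _ hx =>
    simp only [map_smul, LinearMap.smul_apply, smul_eq_mul]
    exact (hx.mul_left n).mul_left n

theorem toBilin'_E₈_symm (x y : Fin 8 → ℤ) :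
    Matrix.toBilin' CartanMatrix.E₈ x y = Matrix.toBilin' CartanMatrix.E₈ y x := by
  rw [Matrix.toBilin'_apply', Matrix.toBilin'_apply', Matrix.dotProduct_mulVec,
    ← Matrix.mulVec_transpose, CartanMatrix.E₈_transpose, dotProduct_comm]

theorem even_toBilin'_E₈ (x : Fin 8 → ℤ) : Even (Matrix.toBilin' CartanMatrix.E₈ x x) := by
  refine even_apply_self_of_basis _ toBilin'_E₈_symm (Pi.basisFun ℤ (Fin 8)) (fun i => ?_) x
  rw [Pi.basisFun_apply, Matrix.toBilin'_single, CartanMatrix.E₈_diag]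
  exact even_two

/-- The form of `E₈` is unimodular, because its Gram matrix has determinant `1`. -/
theorem dvd_of_dvd_toBilin'_E₈ {n : ℤ} {x : Fin 8 → ℤ}
    (h : ∀ y, n ∣ Matrix.toBilin' CartanMatrix.E₈ x y) (i : Fin 8) : n ∣ x i := by
  have hcoord : ∀ i, n ∣ (CartanMatrix.E₈.mulVec x) i := fun i => by
    have := h (Pi.single i 1)
    rwa [toBilin'_E₈_symm, Matrix.toBilin'_apply', single_one_dotProduct] at this
  have hinv : x = (CartanMatrix.E₈⁻¹).mulVec (CartanMatrix.E₈.mulVec x) := by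
    rw [Matrix.mulVec_mulVec, Matrix.nonsing_inv_mul _ (by simp [CartanMatrix.E₈_det]),
      Matrix.one_mulVec]
  rw [hinv, Matrix.mulVec, dotProduct]
  exact Finset.dvd_sum fun j _ => (hcoord j).mul_left _

theorem evenUnimodularForm_apply (ε : ℤˣ) (p k : ℕ)
    (x y : (Fin p → ℤ × ℤ) × (Fin k → Fin 8 → ℤ)) :
    evenUnimodularForm ε p k x y =
      (∑ i, ((x.1 i).1 * (y.1 i).2 + (x.1 i).2 * (y.1 i).1)) +
        (ε : ℤ) * ∑ j, Matrix.toBilin' CartanMatrix.E₈ (x.2 j) (y.2 j) := rfl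

theorem evenUnimodularForm_divisible (ε : ℤˣ) (p k : ℕ) (n : ℤ)
    (c : (Fin p → ℤ × ℤ) × (Fin k → Fin 8 → ℤ)) (hc : ∀ y, n ∣ evenUnimodularForm ε p k c y) :
    ∃ c₀, c = n • c₀ := by
  have h₁ : ∀ i, n ∣ (c.1 i).1 := fun i => by
    have := hc (Pi.single i (0, 1), 0)
    simpa [evenUnimodularForm_apply, Pi.single_apply, apply_ite, Finset.sum_add_distrib] using this
  have h₂ : ∀ i, n ∣ (c.1 i).2 := fun i => by
    have := hc (Pi.single i (1, 0), 0)
    simpa [evenUnimodularForm_apply, Pi.single_apply, apply_ite, Finset.sum_add_distrib] using this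
  have h₃ : ∀ j i, n ∣ c.2 j i := fun j => dvd_of_dvd_toBilin'_E₈ fun y => by
    have := hc (0, Pi.single j y)
    rw [evenUnimodularForm_apply, Finset.sum_eq_single j
      (fun l _ hl => by simp [Pi.single_eq_of_ne hl]) (by simp)] at this
    simpa [(Units.isUnit ε).dvd_mul_left] using this
  choose a ha using h₁
  choose a' ha' using h₂
  choose d hd using h₃
  refine ⟨(fun i => (a i, a' i), d), ?_⟩
  ext
  · exact ha _
  · exact ha' _
  · exact hd _ _

/-- The embedding of `H ⊕ H` as the first two summands of the lattice. -/
def embedTwoPlanes {p : ℕ} (hp : 2 ≤ p) (k : ℕ) (x : ℤ × ℤ × ℤ × ℤ) :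
    (Fin p → ℤ × ℤ) × (Fin k → Fin 8 → ℤ) :=
  (Pi.single (M := fun _ => ℤ × ℤ) ⟨0, by omega⟩ (x.1, x.2.1) +
    Pi.single (M := fun _ => ℤ × ℤ) ⟨1, by omega⟩ (x.2.2.1, x.2.2.2), 0)

theorem evenUnimodularForm_embedTwoPlanes (ε : ℤˣ) {p : ℕ} (hp : 2 ≤ p) (k : ℕ)
    (c : (Fin p → ℤ × ℤ) × (Fin k → Fin 8 → ℤ)) (x : ℤ × ℤ × ℤ × ℤ) :
    evenUnimodularForm ε p k c (embedTwoPlanes hp k x) =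
      twoPlanes ((c.1 ⟨0, by omega⟩).1, (c.1 ⟨0, by omega⟩).2,
        (c.1 ⟨1, by omega⟩).1, (c.1 ⟨1, by omega⟩).2) x := by
  have h : ∀ (i : Fin p) (z : ℤ × ℤ), evenUnimodularForm ε p k c (Pi.single (M := fun _ => ℤ × ℤ) i z, 0) =
      (c.1 i).1 * z.2 + (c.1 i).2 * z.1 := fun i z => by
    rw [evenUnimodularForm_apply, Finset.sum_eq_single i
      (fun l _ hl => by simp [Pi.single_eq_of_ne hl]) (by simp)]
    simp
  have hsum : embedTwoPlanes hp k x =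
      (Pi.single (M := fun _ => ℤ × ℤ) ⟨0, by omega⟩ (x.1, x.2.1), 0) +
        (Pi.single (M := fun _ => ℤ × ℤ) ⟨1, by omega⟩ (x.2.2.1, x.2.2.2), 0) := by
    simp [embedTwoPlanes]
  rw [hsum, map_add, h, h]
  simp only [twoPlanes]
  ring

theorem isEvenUnimodularWithPlanes_evenUnimodularForm (ε : ℤˣ) {p : ℕ} (hp : 2 ≤ p) (k : ℕ) :
    IsEvenUnimodularWithPlanes (evenUnimodularForm ε p k) := by
  refine ⟨fun x y => ?_, fun x => ?_, evenUnimodularForm_divisible ε p k, fun c => ?_⟩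
  · simp only [evenUnimodularForm_apply, toBilin'_E₈_symm (x.2 _)]
    congr 1
    exact Finset.sum_congr rfl fun i _ => by ring
  · rw [evenUnimodularForm_apply]
    refine Even.add (Finset.even_sum _ fun i _ => ⟨(x.1 i).1 * (x.1 i).2, by ring⟩) ?_
    exact (Finset.even_sum _ fun j _ => even_toBilin'_E₈ _).mul_left _
  · obtain ⟨e, f, h₁, h₂, h₃, h₄, h₅⟩ := exists_hyperbolic_pair_orthogonal
      ((c.1 ⟨0, by omega⟩).1, (c.1 ⟨0, by omega⟩).2, (c.1 ⟨1, by omega⟩).1, (c.1 ⟨1, by omega⟩).2)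
    have hform : ∀ x y, evenUnimodularForm ε p k (embedTwoPlanes hp k x) (embedTwoPlanes hp k y) =
        twoPlanes x y := fun x y => by
      rw [evenUnimodularForm_embedTwoPlanes]
      simp [embedTwoPlanes]
    refine ⟨embedTwoPlanes hp k e, embedTwoPlanes hp k f, ?_⟩
    simp only [hform, evenUnimodularForm_embedTwoPlanes ε hp k c]
    exact ⟨h₁, h₂, h₃, h₄, h₅⟩

/-! ### Classes adapted to a given class -/

section Lattice

variable {Λ : Type*} [AddCommGroup Λ] {b : LinearMap.BilinForm ℤ Λ}

theorem isPrimitiveClass_of_apply_eq_one {L z : Λ} (h : b L z = 1) : IsPrimitiveClass L := by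
  rintro n y rfl
  rw [map_smul, LinearMap.smul_apply, smul_eq_mul] at h
  exact IsUnit.of_mul_eq_one _ h

theorem IsEvenUnimodularWithPlanes.exists_primitive_part (hb : IsEvenUnimodularWithPlanes b)
    (c : Λ) : ∃ (n : ℤ) (c₀ y : Λ), c = n • c₀ ∧ b c₀ y = 1 := by
  by_cases hc : c = 0
  · obtain ⟨e, f, -, -, h, -⟩ := hb.exists_plane 0
    exact ⟨0, e, f, by simp [hc], h⟩
  -- `n` generates the ideal of all values `c · y`.
  obtain ⟨n, hn⟩ := (inferInstance : (LinearMap.range (b c)).IsPrincipal)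
  have hdvd : ∀ y, n ∣ b c y := fun y => by
    rw [← Ideal.mem_span_singleton, Ideal.span, ← hn]
    exact ⟨y, rfl⟩
  obtain ⟨y, hy⟩ : ∃ y, b c y = n := by
    have : n ∈ LinearMap.range (b c) := hn ▸ Submodule.mem_span_singleton_self n
    exact this
  obtain ⟨c₀, rfl⟩ := hb.divisible n c hdvd
  refine ⟨n, c₀, y, rfl, ?_⟩
  have hn₀ : n ≠ 0 := fun h => hc (by simp [h])
  rw [map_smul, LinearMap.smul_apply, smul_eq_mul] at hy
  exact mul_left_cancel₀ hn₀ (by rw [hy, mul_one])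

/-- The class dual to `c` can be taken orthogonal to the hyperbolic plane, by subtracting
its projection. -/
theorem IsEvenUnimodularWithPlanes.exists_dual_and_plane (hb : IsEvenUnimodularWithPlanes b)
    {c z : Λ} (hz : b c z = 1) : ∃ y e f, b c y = 1 ∧ b e e = 0 ∧ b f f = 0 ∧ b e f = 1 ∧
      b c e = 0 ∧ b c f = 0 ∧ b y e = 0 ∧ b y f = 0 := by
  obtain ⟨e, f, hee, hff, hef, hce, hcf⟩ := hb.exists_plane c
  refine ⟨z - b z f • e - b z e • f, e, f, ?_, hee, hff, hef, hce, hcf, ?_, ?_⟩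
  · simp [hz, hce, hcf]
  · simp [hee, hb.symm f e, hef]
  · simp [hff, hef]

/-! ### Moves in the orbit of `(0, 0, 1)` -/

theorem mukaiForm_apply (x y : ℤ × Λ × ℤ) :
    mukaiForm b x y = b x.2.1 y.2.1 - x.1 * y.2.2 - y.1 * x.2.2 := rfl

theorem minusTwoReflection_apply {M : Type*} [AddCommGroup M] (B : LinearMap.BilinForm ℤ M) (u : M)
    (hu : B u u = -2) (x : M) : minusTwoReflection B u hu x = x + B u x • u := by
  simp [minusTwoReflection, Module.reflection_apply]

/-- The subgroup generated by `O(Λ)` and the reflections. -/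
def generatedSubgroup (b : LinearMap.BilinForm ℤ Λ) (m : ℤ) :
    Subgroup ((ℤ × Λ × ℤ) ≃ₗ[ℤ] (ℤ × Λ × ℤ)) :=
  Subgroup.closure
    ((gammaZero b : Set ((ℤ × Λ × ℤ) ≃ₗ[ℤ] (ℤ × Λ × ℤ))) ∪ lineBundleReflections b m)

/-- The effect of the reflection in `(1, -L, m)` on the vector `(a, c, 1 + m a)`. -/
theorem exists_reflection {m : ℤ} {L z : Λ} (hL : b L L = 2 * m - 2) (hz : b L z = 1) :
    ∃ h ∈ generatedSubgroup b m, ∀ (a : ℤ) (c : Λ) (t : ℤ), t = -(b L c + 1 + 2 * m * a) →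
      h (a, c, 1 + m * a) = (a + t, c - t • L, 1 + m * (a + t)) := by
  have hu : mukaiForm b (1, -L, m) (1, -L, m) = -2 := by
    simp only [mukaiForm_apply, map_neg, LinearMap.neg_apply, neg_neg, hL]
    ring
  refine ⟨minusTwoReflection (mukaiForm b) (1, -L, m) hu, Subgroup.subset_closure (Or.inr
    ⟨L, hu, isPrimitiveClass_of_apply_eq_one hz, hL, rfl⟩), fun a c t ht => ?_⟩
  have hval : mukaiForm b (1, -L, m) (a, c, 1 + m * a) = t := by
    simp only [mukaiForm_apply, map_neg, LinearMap.neg_apply, ht]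
    ring
  rw [minusTwoReflection_apply, hval]
  ext
  · simp
  · simp [sub_eq_add_neg]
  · simp
    ring

/-- The vector `(a, c, 1 + m a)` is moved to one whose class in `Λ` is primitive. Here the
reflection uses a class `L` orthogonal to `c = n c₀`, so that `c' = n c₀ + (1 + 2 m a) L`. The
coefficients are coprime: if `c₀ · c₀ = 2 h`, then `n² h = a (1 + m a)` and
`(1 + 2 m a)² = 1 + 4 m n² h`. -/
theorem IsEvenUnimodularWithPlanes.exists_move_to_primitive (hb : IsEvenUnimodularWithPlanes b)
    {m a : ℤ} {c : Λ} (hc : b c c = 2 * a * (1 + m * a)) :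
    ∃ h ∈ generatedSubgroup b m, ∃ a' c' z, h (a, c, 1 + m * a) = (a', c', 1 + m * a') ∧
      b c' z = 1 := by
  obtain ⟨n, c₀, z, rfl, hz⟩ := hb.exists_primitive_part c
  obtain ⟨y, e, f, hy, hee, hff, hef, hce, hcf, hye, hyf⟩ := hb.exists_dual_and_plane hz
  have hfe : b f e = 1 := by rw [hb.symm, hef]
  obtain ⟨h, hh⟩ := hb.even c₀
  have hn : n * (n * h) = a * (1 + m * a) := by
    simp only [map_smul, LinearMap.smul_apply, smul_eq_mul, hh] at hc
    linarith
  obtain ⟨g, hg, hgx⟩ := exists_reflection (b := b) (m := m) (L := e + (m - 1) • f) (z := f)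
    (by simp [hee, hff, hef, hfe]; ring) (by simp [hef, hff])
  have hec : b e c₀ = 0 := by rw [hb.symm, hce]
  have hfc : b f c₀ = 0 := by rw [hb.symm, hcf]
  refine ⟨g, hg, _, _, -(4 * m * n * h) • y + (1 + 2 * m * a) • f,
    hgx a _ (-(1 + 2 * m * a)) (by simp [hec, hfc]), ?_⟩
  simp [hy, hcf, hef, hff, hb.symm e y, hb.symm f y, hye, hyf]
  linear_combination (-4 * m) * hn

/-- If `c` is primitive, then the vector `(a, c, 1 + m a)` is moved to one with first coordinate
`-1` and still with a primitive class. -/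
theorem IsEvenUnimodularWithPlanes.exists_move_to_neg_one (hb : IsEvenUnimodularWithPlanes b)
    {m a : ℤ} {c z : Λ} (hz : b c z = 1) :
    ∃ h ∈ generatedSubgroup b m, ∃ c' z', h (a, c, 1 + m * a) = (-1, c', 1 + m * (-1)) ∧
      b c' z' = 1 := by
  obtain ⟨y, e, f, hy, hee, hff, hef, hce, hcf, hye, hyf⟩ := hb.exists_dual_and_plane hz
  have hfe : b f e = 1 := by rw [hb.symm, hef]
  have hey : b e y = 0 := by rw [hb.symm, hye]
  have hfy : b f y = 0 := by rw [hb.symm, hyf]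
  have hec : b e c = 0 := by rw [hb.symm, hce]
  have hfc : b f c = 0 := by rw [hb.symm, hcf]
  have hyc : b y c = 1 := by rw [hb.symm, hy]
  obtain ⟨q, hq⟩ := hb.even y
  -- The value `x = L · c` for which the reflection takes `a` to `-1`.
  obtain ⟨x, hx⟩ : ∃ x, x = a - 2 * m * a := ⟨_, rfl⟩
  obtain ⟨g, hg, hgx⟩ := exists_reflection (b := b) (m := m)
    (L := x • y + e + (m - 1 - x ^ 2 * q) • f) (z := f)
    (by simp [hee, hff, hef, hfe, hye, hyf, hey, hfy, hq]; ring) (by simp [hyf, hef, hff])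
  have hgx' := hgx a c (-1 - a) (by simp [hyc, hec, hfc, hx]; ring)
  rw [add_sub_cancel] at hgx'
  -- With `c' = c + (1 + a) L` one has `c' · f = 1 + a` and `c' · y = 1 + (1 + a) x (y · y)`.
  refine ⟨g, hg, _, y - (x * (2 * q)) • f, hgx', ?_⟩
  simp [hy, hcf, hef, hff, hyf, hey, hfy, hq]
  ring

/-! ### The stabilizer -/

theorem mem_mukaiStabilizer {v : ℤ × Λ × ℤ} {g : (ℤ × Λ × ℤ) ≃ₗ[ℤ] (ℤ × Λ × ℤ)} :
    g ∈ mukaiStabilizer b v ↔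
      (∀ x y, mukaiForm b (g x) (g y) = mukaiForm b x y) ∧ g v = v := Iff.rfl

theorem mem_isometryGroup {M : Type*} [AddCommGroup M] {B : LinearMap.BilinForm ℤ M}
    {g : M ≃ₗ[ℤ] M} : g ∈ isometryGroup B ↔ ∀ x y, B (g x) (g y) = B x y := Iff.rfl

/-- A reflection in `u` fixes `v` when `u` is orthogonal to `v`, and `(1, -L, m)` is orthogonal to
`(1, 0, -m)`. -/
theorem generatedSubgroup_le_mukaiStabilizer (hb : ∀ x y, b x y = b y x) (m : ℤ) :
    generatedSubgroup b m ≤ mukaiStabilizer b (1, 0, -m) := by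
  refine (Subgroup.closure_le _).2 (Set.union_subset ?_ ?_)
  · rintro _ ⟨g, hg, rfl⟩
    refine mem_mukaiStabilizer.2 ⟨fun x y => ?_, by simp⟩
    simp [mukaiForm_apply, mem_isometryGroup.1 hg _ _]
  · rintro _ ⟨L, hu, -, -, rfl⟩
    refine mem_mukaiStabilizer.2 ⟨fun x y => ?_, ?_⟩
    · have hsymm : mukaiForm b x (1, -L, m) = mukaiForm b (1, -L, m) x := by
        rw [mukaiForm_apply, mukaiForm_apply, hb]
        ring
      simp only [minusTwoReflection_apply, map_add, map_smul, LinearMap.add_apply,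
        LinearMap.smul_apply, smul_eq_mul, hu, hsymm]
      ring
    · rw [minusTwoReflection_apply]
      simp [mukaiForm_apply]

/-- An isometry fixing `(1, 0, 0)` and `(0, 0, 1)` preserves their orthogonal complement `Λ`. -/
theorem apply_eq_of_fixes {g : (ℤ × Λ × ℤ) ≃ₗ[ℤ] (ℤ × Λ × ℤ)}
    (hg : g ∈ isometryGroup (mukaiForm b)) (h₁ : g (1, 0, 0) = (1, 0, 0))
    (h₂ : g (0, 0, 1) = (0, 0, 1)) (c : Λ) : g (0, c, 0) = (0, (g (0, c, 0)).2.1, 0) := by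
  have e₁ := mem_isometryGroup.1 hg (0, c, 0) (0, 0, 1)
  have e₂ := mem_isometryGroup.1 hg (0, c, 0) (1, 0, 0)
  rw [h₂] at e₁
  rw [h₁] at e₂
  simp only [mukaiForm_apply, map_zero, mul_one, mul_zero, zero_mul, one_mul, sub_zero, zero_sub,
    neg_eq_zero] at e₁ e₂
  ext
  · exact e₁
  · rfl
  · exact e₂

theorem mem_gammaZero {g : (ℤ × Λ × ℤ) ≃ₗ[ℤ] (ℤ × Λ × ℤ)}
    (hg : g ∈ isometryGroup (mukaiForm b)) (h₁ : g (1, 0, 0) = (1, 0, 0))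
    (h₂ : g (0, 0, 1) = (0, 0, 1)) : g ∈ gammaZero b := by
  have hΛ := apply_eq_of_fixes hg h₁ h₂
  have hΛ' := apply_eq_of_fixes (inv_mem hg) (g.symm_apply_eq.2 h₁.symm)
    (g.symm_apply_eq.2 h₂.symm)
  let φ : Λ →ₗ[ℤ] Λ := LinearMap.fst ℤ Λ ℤ ∘ₗ LinearMap.snd ℤ ℤ (Λ × ℤ) ∘ₗ
    g.toLinearMap ∘ₗ LinearMap.inr ℤ ℤ (Λ × ℤ) ∘ₗ LinearMap.inl ℤ Λ ℤ
  let ψ : Λ →ₗ[ℤ] Λ := LinearMap.fst ℤ Λ ℤ ∘ₗ LinearMap.snd ℤ ℤ (Λ × ℤ) ∘ₗ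
    (g⁻¹).toLinearMap ∘ₗ LinearMap.inr ℤ ℤ (Λ × ℤ) ∘ₗ LinearMap.inl ℤ Λ ℤ
  have hφ : ∀ c, g (0, c, 0) = (0, φ c, 0) := hΛ
  have hψ : ∀ c, g⁻¹ (0, c, 0) = (0, ψ c, 0) := hΛ'
  have hφψ : φ ∘ₗ ψ = LinearMap.id := by
    ext c
    have : g (g⁻¹ (0, c, 0)) = (0, c, 0) := g.apply_symm_apply _
    rw [hψ, hφ] at this
    exact congrArg (fun x => x.2.1) this
  have hψφ : ψ ∘ₗ φ = LinearMap.id := by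
    ext c
    have : g⁻¹ (g (0, c, 0)) = (0, c, 0) := g.symm_apply_apply _
    rw [hφ, hψ] at this
    exact congrArg (fun x => x.2.1) this
  refine ⟨LinearEquiv.ofLinearMap φ ψ hφψ hψφ, mem_isometryGroup.2 fun x y => ?_, ?_⟩
  · have := mem_isometryGroup.1 hg (0, x, 0) (0, y, 0)
    rw [hφ, hφ] at this
    simpa [mukaiForm_apply] using this
  · ext1 x
    obtain ⟨r, c, s⟩ := x
    have hx : ((r, c, s) : ℤ × Λ × ℤ) = r • (1, 0, 0) + (0, c, 0) + s • (0, 0, 1) := by simp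
    rw [hx, map_add g, map_add g, map_smul g, map_smul g, h₁, h₂, hφ]
    simp

/-- The vectors `(a, c, 1 + m a)` in question are the isotropic ones pairing to `-1` with
`(1, 0, -m)`, and `(0, 0, 1)` is one of them. -/
theorem exists_apply_eq_of_mem_mukaiStabilizer {m : ℤ} {g : (ℤ × Λ × ℤ) ≃ₗ[ℤ] (ℤ × Λ × ℤ)}
    (hg : g ∈ mukaiStabilizer b (1, 0, -m)) :
    ∃ a c, g (0, 0, 1) = (a, c, 1 + m * a) ∧ b c c = 2 * a * (1 + m * a) := by
  obtain ⟨hB, hv⟩ := mem_mukaiStabilizer.1 hg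
  have h₁ := hB (1, 0, -m) (0, 0, 1)
  have h₂ := hB (0, 0, 1) (0, 0, 1)
  rw [hv] at h₁
  generalize g (0, 0, 1) = x at h₁ h₂ ⊢
  obtain ⟨a, c, s⟩ := x
  simp [mukaiForm_apply] at h₁ h₂
  obtain rfl : s = 1 + m * a := by linarith
  exact ⟨a, c, rfl, by linarith⟩

/-- The generated subgroup acts transitively on the orbit of `(0, 0, 1)` under the stabilizer. -/
theorem IsEvenUnimodularWithPlanes.exists_move_to_base (hb : IsEvenUnimodularWithPlanes b) {m : ℤ}
    {g : (ℤ × Λ × ℤ) ≃ₗ[ℤ] (ℤ × Λ × ℤ)} (hg : g ∈ mukaiStabilizer b (1, 0, -m)) :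
    ∃ h ∈ generatedSubgroup b m, (h * g) (0, 0, 1) = (0, 0, 1) := by
  have hle := generatedSubgroup_le_mukaiStabilizer hb.symm m
  obtain ⟨a, c, hx, hc⟩ := exists_apply_eq_of_mem_mukaiStabilizer hg
  obtain ⟨h₁, hh₁, a', c', z, hx', hz⟩ := hb.exists_move_to_primitive hc
  obtain ⟨h₂, hh₂, L, z', hx'', hz'⟩ := hb.exists_move_to_neg_one (m := m) (a := a') hz
  have hval : (h₂ * h₁ * g) (0, 0, 1) = (-1, L, 1 + m * (-1)) := by
    simp only [LinearEquiv.mul_apply, hx, hx', hx'']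
  -- The class `L` has the right square because the vector is still isotropic.
  obtain ⟨a₀, c₀, hx₀, hc₀⟩ := exists_apply_eq_of_mem_mukaiStabilizer
    (mul_mem (mul_mem (hle hh₂) (hle hh₁)) hg)
  obtain ⟨ha, hc', -⟩ : -1 = a₀ ∧ L = c₀ ∧ 1 + m * (-1) = 1 + m * a₀ := by
    simpa using hval.symm.trans hx₀
  subst ha hc'
  obtain ⟨h₃, hh₃, hx₃⟩ := exists_reflection (b := b) (m := m) (L := L) (z := z')
    (by linarith) hz'
  refine ⟨h₃ * (h₂ * h₁), mul_mem hh₃ (mul_mem hh₂ hh₁), ?_⟩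
  rw [mul_assoc, LinearEquiv.mul_apply, hval, hx₃ (-1) L 1 (by linarith)]
  simp

end Lattice

theorem mainTheorem9 (ε : ℤˣ) (p k : ℕ) (hp : 3 ≤ p)
    {Λ : Type*} [AddCommGroup Λ] (b : LinearMap.BilinForm ℤ Λ)
    (hb : b.Equivalent (evenUnimodularForm ε p k))
    (m : ℤ) (hm : 1 ≤ m) :
    mukaiStabilizer b (1, 0, -m) =
      Subgroup.closure
        ((gammaZero b : Set ((ℤ × Λ × ℤ) ≃ₗ[ℤ] (ℤ × Λ × ℤ))) ∪ lineBundleReflections b m) := by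
  have hΛ : IsEvenUnimodularWithPlanes b :=
    .of_equivalent hb (isEvenUnimodularWithPlanes_evenUnimodularForm ε (by omega) k)
  have hle := generatedSubgroup_le_mukaiStabilizer hΛ.symm m
  refine le_antisymm (fun g hg => ?_) hle
  obtain ⟨h, hh, he⟩ := hΛ.exists_move_to_base hg
  obtain ⟨hB, hv⟩ := mem_mukaiStabilizer.1 (mul_mem (hle hh) hg)
  have h₁ : (h * g) (1, 0, 0) = (1, 0, 0) := by
    have hsum : ((1, 0, 0) : ℤ × Λ × ℤ) = (1, 0, -m) + m • (0, 0, 1) := by simp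
    rw [hsum, map_add, map_smul, he, hv]
  have hmem : h * g ∈ generatedSubgroup b m :=
    Subgroup.subset_closure (Or.inl (mem_gammaZero hB h₁ he))
  exact (Subgroup.mul_mem_cancel_left _ hh).1 hmem
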